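/- Let $n\ge 2$ and let $D_n$ be the dipole, i.e. the multigraph with two vertices $u,v$ joined by $n$ parallel edges. An (orientable 2-cell) embedding of $D_n$ is given by its local rotations: a cyclic permutation $\pi_u$ of all $n$ darts (half-edges) at $u$ and a cyclic permutation $\pi_v$ of all $n$ darts at $v$. The faces of the embedding are the cycles of the permutation $\rho\,\pi_u\pi_v$ of the set of all $2n$ darts, where $\rho$ is the involution exchanging the two darts of each edge. Let $F$ be the number of faces of an embedding of $D_n$ chosen uniformly at random among all its embeddings, and let $H_m=\sum_{i=1}^m \frac1i$. Then $$ \mathbb{E}(F)=\begin{cases} H_{n-1}+\dfrac{2}{n}, & n \text{ even},\\[2mm] H_{n-1}+\dfrac{2}{n+1}, & n \text{ odd}.\end{cases} $$ Equivalently, $\mathbb{E}(F)=H_{n-1}+\lceil n/2\rceil^{-1}$. -/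

import Mathlib

/-- A multigraph (loops and parallel edges allowed) with vertex set `V`, given by its darts
(half-edges): each dart `d` is incident with the vertex `vert d`, and the two darts of an edge
are swapped by the fixed-point-free involution `rev`. So the edges are the pairs `{d, rev d}`. -/
structure DartGraph (V D : Type*) where
  vert : D → V
  rev : Equiv.Perm D
  rev_rev : ∀ d, rev (rev d) = d
  rev_ne : ∀ d, rev d ≠ d

namespace DartGraph

variable {V D : Type*}

/-- The darts incident with the vertex `v`. -/
abbrev DartsAt (G : DartGraph V D) (v : V) : Type _ := {d : D // G.vert d = v}

/-- A 2-cell embedding of `G` in an oriented surface (up to equivalence), represented by its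
local rotations: for each vertex `v`, a cyclic permutation `rot v` of all the darts incident
with `v` (a single cycle passing through all of them). -/
@[ext]
structure Embedding (G : DartGraph V D) where
  rot : ∀ v, Equiv.Perm (G.DartsAt v)
  isCycleOn : ∀ v, (rot v).IsCycleOn Set.univ

namespace Embedding

variable {G : DartGraph V D}

/-- The product of all local rotations, as a permutation of the set of all darts. -/
def vertexPerm (M : G.Embedding) : Equiv.Perm D :=
  (Equiv.sigmaFiberEquiv G.vert).permCongr (Equiv.Perm.sigmaCongrRight M.rot)

/-- The face permutation: from a dart, go to the next dart in the local rotation at its vertex,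
and then to the other dart of the same edge. -/
def facePerm (M : G.Embedding) : Equiv.Perm D := G.rev * M.vertexPerm

/-- The faces of an embedding are the cycles (orbits) of the face permutation. -/
def Face (M : G.Embedding) : Type _ := Quotient (Equiv.Perm.SameCycle.setoid M.facePerm)

/-- The number of faces. -/
noncomputable def numFaces (M : G.Embedding) : ℕ := Nat.card M.Face

/-- All sets of embeddings are events. -/
instance : MeasurableSpace G.Embedding := ⊤

end Embedding

/-- The expected number of faces of an embedding of `G` chosen uniformly at random among all
its embeddings. -/
noncomputable def expectedFaces (G : DartGraph V D) : ℝ :=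
  ∫ M : G.Embedding, (M.numFaces : ℝ) ∂(ProbabilityTheory.uniformOn Set.univ)

end DartGraph

/-- The dipole: two vertices `false`, `true` and `n` parallel edges; the edge `e` has the two
darts `(e, false)` and `(e, true)`, incident with `false` and with `true` respectively. -/
def dipole (n : ℕ) : DartGraph Bool (Fin n × Bool) where
  vert d := d.2
  rev := (Equiv.refl (Fin n)).prodCongr Equiv.boolNot
  rev_rev d := by
    rcases d with ⟨e, b⟩
    cases b <;> simp
  rev_ne d := by
    rcases d with ⟨e, b⟩
    cases b <;> simp

/-! An embedding is a pair of full cycles `σ`, `τ` on the `n` edges. Faces alternate between the two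
vertices, so two steps of the face permutation read off the product, and faces correspond to cycles
of `σ * τ` (`numFaces_eq`). What is needed is the mean number of cycles of a product of two random
`n`-cycles.

Adjoin a point to get `N = n + 1` points. A full cycle there is an `n`-cycle with the new point
spliced in; a near cycle fixing the new point is an `n`-cycle with that point added. Their product
is `σ * τ` with the new point spliced in, so it has as many cycles as `σ * τ`. Averages of
conjugation-invariant functions over all near cycles reduce to those fixing the new point. Hence the
mean is that for a full cycle times a near cycle on `N` points, and this product is uniform on odd
permutations (`card_nearCycles_mul_eq`, `sum_fullCycles_mul`).

For uniformity, fix `π` and count the near cycles `τ` with `π * τ` a full cycle. A principal minor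
of the identity minus the permutation matrix is `1` for full cycles and `0` otherwise; expanded by
rows it is a signed sum over sets `s` avoiding a root (`sum_restrictSign`). Summed over `τ`, the
terms with `2 ≤ #s ≤ N - 2` vanish (`sum_nearCycles_restrictSign`). The empty set, the singletons
and the complement of the root leave `k * (1 - sign π)`, where `k` counts near cycles with a given
fixed point.

The mean over odd permutations then follows from the sums of `cycleCount` and `sign * cycleCount`
over all permutations, both computed by adding one point at a time. -/

namespace DipoleFaces

open Equiv Equiv.Perm Finset

/-! ### Counting cycles, and inserting a point into a cycle. -/

section CycleCount

variable {α β : Type*}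

/-- The number of cycles of a permutation, fixed points included. -/
noncomputable def cycleCount (σ : Perm α) : ℕ := Nat.card (Quotient (SameCycle.setoid σ))

theorem sameCycle_apply (σ : Perm α) (x : α) : σ.SameCycle x (σ x) := ⟨1, by simp⟩

theorem SameCycle.map_of_step {σ : Perm α} {τ : Perm β} {f : α → β}
    (hf : ∀ x, τ.SameCycle (f x) (f (σ x))) {x y : α} (h : σ.SameCycle x y) :
    τ.SameCycle (f x) (f y) := by
  obtain ⟨i, rfl⟩ := h
  induction i with
  | zero => simp [SameCycle.refl]
  | succ i ih =>
    rw [add_comm, zpow_add, zpow_one, Perm.mul_apply]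
    exact ih.trans (hf _)
  | pred i ih =>
    refine ih.trans ?_
    have := hf ((σ ^ (-(i : ℤ) - 1)) x)
    rw [← Perm.mul_apply, ← zpow_one_add] at this
    simpa using this.symm

/-- Maps respecting cycles step by step descend to the quotients, where they are mutually inverse;
they need not be bijections themselves. -/
theorem cycleCount_eq_of_maps {σ : Perm α} {τ : Perm β} (f : α → β) (g : β → α)
    (hf : ∀ x, τ.SameCycle (f x) (f (σ x))) (hg : ∀ y, σ.SameCycle (g y) (g (τ y)))
    (hgf : ∀ x, σ.SameCycle (g (f x)) x) (hfg : ∀ y, τ.SameCycle (f (g y)) y) :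
    cycleCount σ = cycleCount τ := by
  refine Nat.card_congr ⟨Quotient.map' f fun _ _ h => SameCycle.map_of_step hf h,
    Quotient.map' g fun _ _ h => SameCycle.map_of_step hg h, ?_, ?_⟩
  · rintro ⟨x⟩
    exact Quotient.sound' (hgf x)
  · rintro ⟨y⟩
    exact Quotient.sound' (hfg y)

theorem cycleCount_permCongr (e : α ≃ β) (σ : Perm α) :
    cycleCount (e.permCongr σ) = cycleCount σ := by
  refine cycleCount_eq_of_maps e.symm e (fun x => ?_) (fun x => ?_) (fun x => ?_) (fun x => ?_)
  · simpa using sameCycle_apply σ (e.symm x)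
  · simpa using sameCycle_apply (e.permCongr σ) (e x)
  · simp [SameCycle.refl]
  · simp [SameCycle.refl]

theorem cycleCount_conj (g σ : Perm α) : cycleCount (g * σ * g⁻¹) = cycleCount σ :=
  cycleCount_permCongr g σ

theorem cycleCount_mul_comm (σ τ : Perm α) : cycleCount (σ * τ) = cycleCount (τ * σ) := by
  rw [← cycleCount_conj τ (σ * τ)]
  congr 1
  group

theorem cycleCount_inv (σ : Perm α) : cycleCount σ⁻¹ = cycleCount σ :=
  cycleCount_eq_of_maps id id
    (fun x => by simpa using sameCycle_apply σ⁻¹ x |>.inv)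
    (fun x => by simpa using (sameCycle_apply σ x))
    (fun x => SameCycle.refl _ _) (fun x => SameCycle.refl _ _)

theorem cycleCount_pos [Finite α] [Nonempty α] (σ : Perm α) : 0 < cycleCount σ :=
  have : Nonempty (Quotient (SameCycle.setoid σ)) := ⟨Quotient.mk _ (Classical.arbitrary α)⟩
  Nat.card_pos

theorem cycleCount_eq_one_iff [Nonempty α] {σ : Perm α} :
    cycleCount σ = 1 ↔ ∀ x y, σ.SameCycle x y := by
  rw [cycleCount, Nat.card_eq_one_iff_unique]
  constructor
  · rintro ⟨h, -⟩ x y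
    exact Quotient.exact (Subsingleton.elim (Quotient.mk (SameCycle.setoid σ) x) (Quotient.mk _ y))
  · intro h
    refine ⟨⟨?_⟩, ⟨Quotient.mk _ (Classical.arbitrary α)⟩⟩
    rintro ⟨x⟩ ⟨y⟩
    exact Quotient.sound (h x y)

theorem isCycleOn_univ_iff [Nonempty α] {σ : Perm α} :
    σ.IsCycleOn Set.univ ↔ cycleCount σ = 1 := by
  rw [cycleCount_eq_one_iff]
  exact ⟨fun h x y => h.2 trivial trivial,
    fun h => ⟨Set.bijOn_univ.2 σ.bijective, fun x _ y _ => h x y⟩⟩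

/-- The product sends `a` to `j` and `j` to `τ a`: the fixed point `j` is spliced into the cycle of
`a`, so its own cycle is lost. -/
theorem cycleCount_mul_swap [Finite α] [DecidableEq α] {τ : Perm α} {a j : α} (hj : τ j = j)
    (ha : a ≠ j) : cycleCount (τ * swap a j) + 1 = cycleCount τ := by
  set ρ := τ * swap a j with hρ
  have hne : ∀ {x}, x ≠ j → τ x ≠ j := fun hx h => hx (τ.injective (h.trans hj.symm))
  have hρa : ρ a = j := by simp [hρ, hj]
  have hρj : ρ j = τ a := by simp [hρ]
  have hρx : ∀ {x}, x ≠ a → x ≠ j → ρ x = τ x := fun h1 h2 => by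
    simp [hρ, swap_apply_of_ne_of_ne h1 h2]
  -- Collapsing `j` onto its predecessor `a` undoes the splicing.
  let f : α → α := fun x => if x = j then a else x
  have hfj : ∀ x, f x ≠ j := fun x => by by_cases h : x = j <;> simp [f, h, ha]
  have hf : ∀ x, τ.SameCycle (f x) (f (ρ x)) := fun x => by
    by_cases h1 : x = a
    · simp [h1, hρa, f, SameCycle.refl]
    by_cases h2 : x = j
    · simpa [h2, hρj, f, hne ha] using sameCycle_apply τ a
    · simpa [hρx h1 h2, f, h2, hne h2] using sameCycle_apply τ x
  have hg : ∀ x, ρ.SameCycle (id x) (id (τ x)) := fun x => by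
    by_cases h1 : x = a
    · have := (sameCycle_apply ρ a).trans (sameCycle_apply ρ _)
      simpa [h1, hρa, hρj] using this
    by_cases h2 : x = j
    · simp [h2, hj, SameCycle.refl]
    · simpa [hρx h1 h2] using sameCycle_apply ρ x
  have hfx : ∀ x, ρ.SameCycle x (f x) := fun x => by
    by_cases h : x = j
    · simpa [f, h, hρa] using (sameCycle_apply ρ a).symm
    · simp [f, h, SameCycle.refl]
  let F : Quotient (SameCycle.setoid ρ) → Quotient (SameCycle.setoid τ) :=
    Quotient.map' f fun _ _ h => SameCycle.map_of_step hf h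
  let G : Option (Quotient (SameCycle.setoid ρ)) → Quotient (SameCycle.setoid τ) :=
    fun o => o.elim (Quotient.mk _ j) F
  have hjf : ∀ x, ¬ τ.SameCycle j (f x) := fun x h => hfj x (by
    obtain ⟨i, hi⟩ := h
    rw [← hi, zpow_apply_eq_self_of_apply_eq_self hj])
  have hG : Function.Bijective G := by
    constructor
    · rintro (_ | ⟨⟨x⟩⟩) (_ | ⟨⟨y⟩⟩) h
      · rfl
      · exact (hjf y (Quotient.exact h)).elim
      · exact (hjf x (Quotient.exact h.symm)).elim
      · have h' : τ.SameCycle (f x) (f y) := Quotient.exact h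
        exact congrArg some (Quotient.sound
          ((hfx x).trans ((SameCycle.map_of_step hg h').trans (hfx y).symm)))
    · rintro ⟨x⟩
      by_cases h : x = j
      · exact ⟨none, by subst h; rfl⟩
      · refine ⟨some (Quotient.mk _ x), ?_⟩
        change Quotient.mk _ (f x) = _
        simp only [f, if_neg h]
        rfl
  rw [cycleCount, cycleCount, ← Nat.card_congr (Equiv.ofBijective G hG), Finite.card_option]

theorem cycleCount_swap_mul [Finite α] [DecidableEq α] {τ : Perm α} {a j : α} (hj : τ j = j)
    (ha : a ≠ j) : cycleCount (swap a j * τ) + 1 = cycleCount τ := by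
  rw [cycleCount_mul_comm, cycleCount_mul_swap hj ha]

theorem cycleCount_optionCongr [Finite α] (σ : Perm α) :
    cycleCount (optionCongr σ : Perm (Option α)) = cycleCount σ + 1 := by
  let π : Perm (Option α) := optionCongr σ
  have hs : ∀ x, π.SameCycle (some x) (some (σ x)) := fun x => by
    simpa [π] using sameCycle_apply π (some x)
  let G : Option (Quotient (SameCycle.setoid σ)) → Quotient (SameCycle.setoid π) :=
    fun o => o.elim (Quotient.mk _ none)
      (Quotient.map' some fun _ _ h => SameCycle.map_of_step hs h)
  have hn : ∀ x, ¬ π.SameCycle none (some x) := fun x h => by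
    obtain ⟨i, hi⟩ := h
    rw [zpow_apply_eq_self_of_apply_eq_self (by simp [π])] at hi
    exact absurd hi (by simp)
  have hG : Function.Bijective G := by
    constructor
    · rintro (_ | ⟨⟨x⟩⟩) (_ | ⟨⟨y⟩⟩) h
      · rfl
      · exact (hn y (Quotient.exact h)).elim
      · exact (hn x (Quotient.exact h.symm)).elim
      · have h' : π.SameCycle (some x) (some y) := Quotient.exact h
        refine congrArg some (Quotient.sound ?_)
        have := SameCycle.map_of_step (τ := σ) (f := fun o => o.getD x) (fun z => ?_) h'
        · exact this
        · cases z with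
          | none => simp [π, SameCycle.refl]
          | some z => simpa [π] using sameCycle_apply σ z
    · rintro ⟨_ | x⟩
      · exact ⟨none, rfl⟩
      · exact ⟨some (Quotient.mk _ x), rfl⟩
  rw [cycleCount, cycleCount, ← Nat.card_congr (Equiv.ofBijective G hG), Finite.card_option]

/-- The new point either stays alone, forming an extra cycle, or is spliced into an existing one. -/
theorem cycleCount_swap_none_mul_optionCongr [Finite α] [DecidableEq α] (σ : Perm α)
    (x : Option α) : cycleCount (swap none x * optionCongr σ) =
      cycleCount σ + if x = none then 1 else 0 := by
  by_cases h : x = none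
  · rw [h, swap_self, ← Perm.one_def, one_mul, cycleCount_optionCongr, if_pos rfl]
  · have := cycleCount_swap_mul (τ := (optionCongr σ : Perm (Option α))) (a := x) (j := none)
      (by simp) h
    rw [cycleCount_optionCongr, swap_comm] at this
    simp only [h, if_false]
    omega

end CycleCount

/-! ### Signs of restricted permutations and a matrix-tree identity. -/

section FunctionDet

variable {α : Type*} [Fintype α] [DecidableEq α]

/-- The determinant of the matrix whose row `j` is the basis vector at `g j`: the sign of `g` if
`g` is a permutation, and `0` otherwise. -/
def funDet (g : α → α) : ℤ := Matrix.det (Matrix.of fun j i => if g j = i then 1 else 0)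

theorem funDet_eq_zero {g : α → α} {x y : α} (hxy : x ≠ y) (h : g x = g y) : funDet g = 0 :=
  Matrix.det_zero_of_row_eq hxy (by ext i; simp [h])

theorem funDet_comp_perm (g : α → α) (σ : Perm α) :
    funDet (fun x => g (σ x)) = sign σ * funDet g :=
  Matrix.det_permute σ (Matrix.of fun j i => if g j = i then 1 else 0)

theorem funDet_id : funDet (fun x : α => x) = 1 := by
  rw [← Matrix.det_one (n := α)]
  congr 1

theorem funDet_perm (σ : Perm α) : funDet (fun x => σ x) = sign σ := by
  simpa [funDet_id] using funDet_comp_perm (fun x : α => x) σ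

/-- The sign of the permutation `ω` restricted to `s` if `s` is invariant, and `0` otherwise. -/
def restrictSign (ω : Perm α) (s : Finset α) : ℤ := funDet fun x => if x ∈ s then ω x else x

/-- The extension by the identity sends both `x` and `ω x` to `ω x`, so two rows coincide. -/
theorem restrictSign_eq_zero {ω : Perm α} {s : Finset α} {x : α} (hx : x ∈ s) (h : ω x ∉ s) :
    restrictSign ω s = 0 :=
  funDet_eq_zero (x := x) (y := ω x) (fun e => h (e ▸ hx)) (by simp [hx, h])

theorem restrictSign_empty (ω : Perm α) : restrictSign ω ∅ = 1 := by
  simp [restrictSign, funDet_id]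

theorem restrictSign_singleton (ω : Perm α) (x : α) :
    restrictSign ω {x} = if ω x = x then 1 else 0 := by
  split_ifs with h
  · rw [restrictSign, ← funDet_id (α := α)]
    congr 1
    ext y
    by_cases hy : y = x <;> simp [hy, h]
  · exact restrictSign_eq_zero (mem_singleton_self x) (by simpa using h)

theorem restrictSign_erase (ω : Perm α) (r : α) :
    restrictSign ω (univ.erase r) = if ω r = r then (sign ω : ℤ) else 0 := by
  split_ifs with h
  · rw [restrictSign, ← funDet_perm]
    congr 1
    ext y
    by_cases hy : y = r <;> simp [hy, h]
  · refine restrictSign_eq_zero (x := ω⁻¹ r) ?_ (by simp)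
    simp only [mem_erase, mem_univ, and_true, ne_eq]
    intro e
    exact h (by rw [Perm.inv_eq_iff_eq] at e; exact e.symm)

/-- If `ω'` agrees on `s` with `ω` composed with a transposition of two elements of `s`, the
restricted signs are opposite. -/
theorem restrictSign_swap {ω ω' : Perm α} {s : Finset α} {a b : α} (ha : a ∈ s) (hb : b ∈ s)
    (hab : a ≠ b) (h : ∀ x ∈ s, ω' x = ω (swap a b x)) :
    restrictSign ω' s = - restrictSign ω s := by
  have := funDet_comp_perm (fun x => if x ∈ s then ω x else x) (swap a b)
  rw [sign_swap hab] at this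
  refine Eq.trans (congrArg funDet ?_) (this.trans (by simp [restrictSign]))
  ext x
  have hs : swap a b x ∈ s ↔ x ∈ s := by
    rw [swap_apply_def]
    split_ifs with h1 h2 <;> simp [*]
  by_cases hx : x ∈ s
  · simp [hx, hs, h x hx]
  · have h1 : x ≠ a := fun e => hx (e ▸ ha)
    have h2 : x ≠ b := fun e => hx (e ▸ hb)
    simp [hx, swap_apply_of_ne_of_ne h1 h2]

/-- A matrix-tree identity: the signed count of the invariant sets avoiding `r` detects the
permutations with a single cycle. -/
theorem sum_restrictSign (ω : Perm α) (r : α) :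
    ∑ s ∈ (univ.erase r).powerset, (-1) ^ #s * restrictSign ω s =
      if cycleCount ω = 1 then 1 else 0 := by
  have : Nonempty α := ⟨r⟩
  split_ifs with hc
  · rw [cycleCount_eq_one_iff] at hc
    rw [sum_eq_single ∅]
    · simp [restrictSign_empty]
    · intro s hs hne
      obtain ⟨x, hx⟩ := nonempty_iff_ne_empty.2 hne
      have hr : r ∉ s := fun h => by simpa using mem_powerset.1 hs h
      suffices ∃ y ∈ s, ω y ∉ s by
        obtain ⟨y, hy, hy'⟩ := this
        rw [restrictSign_eq_zero hy hy', mul_zero]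
      by_contra! hinv
      obtain ⟨i, hi⟩ := (hc x r).exists_nat_pow_eq
      have : ∀ i : ℕ, (ω ^ i) x ∈ s := fun i => by
        induction i with
        | zero => simpa using hx
        | succ i ih => rw [pow_succ', Perm.mul_apply]; exact hinv _ ih
      exact hr (hi ▸ this i)
    · simp
  -- Row `j` is the basis vector at `j` minus the one at `ω j`, except that row `r` keeps only the
  -- first. Multilinearity chooses, for each `s`, the second summand on the rows in `s`; when `r ∈
  -- s` this gives a zero row.
  · have hdet : ∑ s ∈ (univ.erase r).powerset, (-1) ^ #s * restrictSign ω s =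
        Matrix.det (Matrix.of ((fun j => if j = r then 0 else -Pi.single (ω j) (1 : ℤ)) +
          fun j => Pi.single j (1 : ℤ))) := by
      have := (Matrix.detRowAlternating (R := ℤ) (n := α)).toMultilinearMap.map_add_univ
        (fun j => if j = r then 0 else -Pi.single (ω j) (1 : ℤ)) (fun j => Pi.single j (1 : ℤ))
      refine Eq.trans ?_ this.symm
      rw [← sum_subset (subset_univ (univ.erase r).powerset)]
      · refine sum_congr rfl fun s hs => ?_
        have hr : r ∉ s := fun h => by simpa using mem_powerset.1 hs h
        have h2 := (Matrix.detRowAlternating (R := ℤ) (n := α)).toMultilinearMap.map_piecewise_smul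
          (fun _ => -1) (fun j => Pi.single (if j ∈ s then ω j else j) (1 : ℤ)) s
        rw [prod_const, smul_eq_mul] at h2
        refine Eq.trans ?_ (h2.symm.trans ?_)
        · congr 1
          change _ = Matrix.det _
          rw [restrictSign, funDet]
          congr 1
          ext i j
          simp [Pi.single_apply, eq_comm]
        · congr 1
          ext i j
          by_cases hi : i ∈ s
          · have : i ≠ r := fun e => hr (e ▸ hi)
            simp [hi, this]
          · simp [hi]
      · intro s _ hs
        have hr : r ∈ s := by
          by_contra h
          exact hs (mem_powerset.2 fun x hx => by
            simp only [mem_erase, mem_univ, and_true]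
            exact fun e => h (e ▸ hx))
        exact Matrix.det_eq_zero_of_row_eq_zero r (by simp [hr])
    rw [hdet, ← Matrix.exists_vecMul_eq_zero_iff]
    rw [cycleCount_eq_one_iff] at hc
    have hx : ∃ x, ¬ ω.SameCycle x r := by
      by_contra! h
      exact hc fun x y => (h x).trans (h y).symm
    classical
    obtain ⟨x, hx⟩ := hx
    -- The indicator of a cycle avoiding `r` is a left null vector: it is constant along cycles and
    -- ignores the exceptional row.
    refine ⟨fun y => if ω.SameCycle x y then 1 else 0, fun h => ?_, ?_⟩
    · simpa [SameCycle.refl] using congrFun h x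
    · ext i
      have hr : ∀ j, (if ω.SameCycle x j then (1 : ℤ) else 0) *
          ((if j = r then 0 else -Pi.single (ω j) (1 : ℤ)) : α → ℤ) i =
          - if j = ω⁻¹ i then (if ω.SameCycle x j then 1 else 0) else 0 := by
        intro j
        by_cases hj : j = r
        · subst hj
          simp [hx]
        · simp only [hj, if_false, Pi.neg_apply, Pi.single_apply, eq_comm (a := j),
            Perm.inv_eq_iff_eq]
          split_ifs <;> simp
      simp only [Matrix.vecMul, dotProduct, Matrix.of_apply, Pi.add_apply, mul_add,
        sum_add_distrib, hr, sum_neg_distrib, sum_ite_eq', mem_univ, if_true]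
      simp [Pi.single_apply, sameCycle_symm_apply_right]

end FunctionDet

/-! ### Near cycles and the sign-reversing involutions. -/

section NearCycle

variable {α : Type*}

/-- A permutation consisting of one fixed point and one further cycle. -/
def IsNearCycle (τ : Perm α) : Prop := cycleCount τ = 2 ∧ ∃ j, τ j = j

namespace IsNearCycle

variable {τ : Perm α} {j : α}

theorem sameCycle (h : IsNearCycle τ) (hj : τ j = j) {x y : α} (hx : x ≠ j) (hy : y ≠ j) :
    τ.SameCycle x y := by
  have hne : ∀ {z}, z ≠ j → ¬ τ.SameCycle z j := fun hz h => hz (by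
    obtain ⟨i, hi⟩ := h.symm
    rw [← hi, zpow_apply_eq_self_of_apply_eq_self hj])
  obtain ⟨p, q, hpq, hu⟩ := Nat.card_eq_two_iff.1 h.1
  have key : ∀ z : Quotient (SameCycle.setoid τ), z = p ∨ z = q := fun z => by
    simpa using hu.ge (Set.mem_univ z)
  refine Quotient.exact (s := SameCycle.setoid τ) ?_
  have h1 : (Quotient.mk (SameCycle.setoid τ) x) ≠ Quotient.mk _ j :=
    fun e => hne hx (Quotient.exact e)
  have h2 : (Quotient.mk (SameCycle.setoid τ) y) ≠ Quotient.mk _ j :=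
    fun e => hne hy (Quotient.exact e)
  rcases key (Quotient.mk _ x) with e1 | e1 <;> rcases key (Quotient.mk _ y) with e2 | e2 <;>
    rcases key (Quotient.mk _ j) with e3 | e3 <;> simp_all

theorem conj (h : IsNearCycle τ) (g : Perm α) : IsNearCycle (g * τ * g⁻¹) := by
  obtain ⟨hc, j, hj⟩ := h
  exact ⟨by rw [cycleCount_conj, hc], g j, by simp [hj]⟩

theorem inv (h : IsNearCycle τ) : IsNearCycle τ⁻¹ := by
  obtain ⟨hc, j, hj⟩ := h
  exact ⟨by rw [cycleCount_inv, hc], j, by rw [Perm.inv_eq_iff_eq, hj]⟩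

/-- A set invariant under a near cycle and containing a point other than the fixed point contains
all such points. -/
theorem mem_of_invariant [Finite α] (h : IsNearCycle τ) (hj : τ j = j) {s : Finset α}
    (hs : ∀ x ∈ s, τ x ∈ s) {x y : α} (hx : x ∈ s) (hxj : x ≠ j) (hyj : y ≠ j) : y ∈ s := by
  obtain ⟨i, hi⟩ := (h.sameCycle hj hxj hyj).exists_nat_pow_eq
  have : ∀ i : ℕ, (τ ^ i) x ∈ s := fun i => by
    induction i with
    | zero => simpa using hx
    | succ i ih => rw [pow_succ', Perm.mul_apply]; exact hs _ ih
  exact hi ▸ this i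

variable [Fintype α] [DecidableEq α]

/-- On two points the identity is a near cycle with two fixed points; a third point excludes this,
since all points other than `j` share a cycle. -/
theorem fixed_unique (hα : 3 ≤ Fintype.card α) (h : IsNearCycle τ) (hj : τ j = j) {i : α}
    (hi : τ i = i) : i = j := by
  by_contra hne
  obtain ⟨x, hx⟩ : ∃ x, x ∉ ({i, j} : Finset α) := by
    by_contra! hall
    have := card_le_card (fun x _ => hall x : (univ : Finset α) ⊆ {i, j})
    rw [card_univ] at this
    have := card_le_two (a := i) (b := j)
    omega
  simp only [mem_insert, mem_singleton, not_or] at hx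
  obtain ⟨k, hk⟩ := h.sameCycle hj hne hx.2
  rw [zpow_apply_eq_self_of_apply_eq_self hi] at hk
  exact hx.1 hk.symm

theorem sign_eq (hα : 3 ≤ Fintype.card α) (h : IsNearCycle τ) :
    sign τ = (-1) ^ Fintype.card α := by
  obtain ⟨j, hj⟩ := h.2
  have hfix : ∀ x, τ x ≠ x ↔ x ≠ j :=
    fun x => not_congr ⟨fun e => h.fixed_unique hα hj e, fun e => e ▸ hj⟩
  have hcycle : τ.IsCycle := by
    have : Nontrivial α := Fintype.one_lt_card_iff_nontrivial.1 (by omega)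
    obtain ⟨x, hx⟩ := exists_ne j
    exact ⟨x, (hfix x).2 hx, fun y hy => h.sameCycle hj hx ((hfix y).1 hy)⟩
  have hsupp : τ.support = univ.erase j := by
    ext x
    simp [hfix]
  rw [hcycle.sign, hsupp, card_erase_of_mem (mem_univ j), card_univ]
  obtain ⟨m, hm⟩ : ∃ m, Fintype.card α = m + 1 := ⟨Fintype.card α - 1, by omega⟩
  rw [hm, pow_succ]
  simp

end IsNearCycle

theorem mem_iff_of_swap_apply [DecidableEq α] {s : Finset α} {x y : α} (h : x ∈ s ↔ y ∈ s) (z : α) :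
    swap x y z ∈ s ↔ z ∈ s := by
  rw [swap_apply_def]
  split_ifs with h1 h2 <;> simp [*]

/-- `t` arises from `s` by exchanging `a` for `b`. -/
structure IsExchange (s t : Finset α) (a b : α) : Prop where
  left_mem : a ∈ s
  left_notMem : a ∉ t
  right_notMem : b ∉ s
  right_mem : b ∈ t
  mem_iff : ∀ x, x ≠ a → x ≠ b → (x ∈ s ↔ x ∈ t)

variable [Fintype α] [DecidableEq α]

theorem IsExchange.compl {s t : Finset α} {a b : α} (h : IsExchange s t a b) :
    IsExchange sᶜ tᶜ b a where
  left_mem := by simpa using h.right_notMem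
  left_notMem := by simpa using h.right_mem
  right_notMem := by simpa using h.left_mem
  right_mem := by simpa using h.left_notMem
  mem_iff x hb ha := by simpa using not_congr (h.mem_iff x ha hb)

/-- Moving the fixed point `j` of a near cycle behind `a`, and turning the element behind `b` into
the new fixed point. -/
theorem IsExchange.move {s t : Finset α} {a b : α} (h : IsExchange s t a b) {τ : Perm α} {j w : α}
    (hτ : IsNearCycle τ) (hj : τ j = j) (hjs : j ∈ s) (hws : w ∉ s) (hwt : w ∉ t)
    (hst : ∀ x, x ∈ s ↔ τ x ∈ t) :
    a ≠ j ∧ τ b ≠ b ∧ τ b ∉ s ∧ IsNearCycle (τ * swap a j * swap b (τ b)) ∧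
      (τ * swap a j * swap b (τ b)) (τ b) = τ b ∧ (τ * swap a j * swap b (τ b)) a = j ∧
      ∀ x, x ∈ s ↔ (τ * swap a j * swap b (τ b)) x ∈ t := by
  obtain ⟨has, hat, hbs, hbt, hmem⟩ := h
  have haj : a ≠ j := fun e => hat (by have := (hst a).1 has; rwa [e, hj, ← e] at this)
  have hut : τ b ∉ t := fun e => hbs ((hst b).2 e)
  have hub : τ b ≠ b := fun e => hut (by rwa [e])
  have hbj : b ≠ j := fun e => hbs (e ▸ hjs)
  -- If `τ b = a`, then `insert b s` is invariant, because `t` is `s` with `a` replaced by `b`. It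
  -- would then contain every point but `j`, in particular `w`.
  have hua : τ b ≠ a := by
    intro e
    have hinv : ∀ x ∈ insert b s, τ x ∈ insert b s := by
      intro x hx
      rw [mem_insert] at hx ⊢
      rcases hx with rfl | hx
      · exact Or.inr (e ▸ has)
      · by_cases hb : τ x = b
        · exact Or.inl hb
        · exact Or.inr ((hmem _ (fun ha => hat (ha ▸ (hst x).1 hx)) hb).2 ((hst x).1 hx))
    have := hτ.mem_of_invariant hj hinv (mem_insert_of_mem has) haj
      (y := w) (fun e => hws (e ▸ hjs))
    rcases mem_insert.1 this with e | e
    · exact hwt (e ▸ hbt)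
    · exact hws e
  have hus : τ b ∉ s := fun e => hut ((hmem _ hua hub).1 e)
  have hab : a ≠ b := fun e => hbs (e ▸ has)
  have hfix : (τ * swap a j * swap b (τ b)) (τ b) = τ b := by
    simp [swap_apply_of_ne_of_ne hab.symm hbj]
  refine ⟨haj, hub, hus, ⟨?_, _, hfix⟩, hfix, ?_, fun x => ?_⟩
  -- Splicing in `j` loses a cycle; splitting off `τ b` regains one. The latter is seen by splicing
  -- `τ b` back in.
  · have h1 := cycleCount_mul_swap hj haj
    have h2 := cycleCount_mul_swap hfix hub.symm
    rw [mul_assoc, swap_mul_self, mul_one] at h2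
    rw [← h2, h1, hτ.1]
  · simp [swap_apply_of_ne_of_ne hab hua.symm, hj]
  · rw [Perm.mul_apply, Perm.mul_apply, ← hst,
      mem_iff_of_swap_apply (by simp [has, hjs]), mem_iff_of_swap_apply (by simp [hbs, hus])]

open Classical in
/-- The involution on near cycles which moves the fixed point between `s` and its complement. -/
noncomputable def moveFixedPoint (s : Finset α) (a b : α) (τ : Perm α) : Perm α :=
  if h : ∃ j, τ j = j then
    if h.choose ∈ s then τ * swap a h.choose * swap b (τ b)
    else τ * swap b h.choose * swap a (τ a)
  else τ

theorem moveFixedPoint_of_mem (hα : 3 ≤ Fintype.card α) {s : Finset α} (a b : α) {τ : Perm α}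
    {j : α} (hτ : IsNearCycle τ) (hj : τ j = j) (hjs : j ∈ s) :
    moveFixedPoint s a b τ = τ * swap a j * swap b (τ b) := by
  have h : ∃ j, τ j = j := ⟨j, hj⟩
  have e : h.choose = j := hτ.fixed_unique hα hj h.choose_spec
  rw [moveFixedPoint, dif_pos h, e, if_pos hjs]

theorem moveFixedPoint_of_notMem (hα : 3 ≤ Fintype.card α) {s : Finset α} (a b : α) {τ : Perm α}
    {j : α} (hτ : IsNearCycle τ) (hj : τ j = j) (hjs : j ∉ s) :
    moveFixedPoint s a b τ = τ * swap b j * swap a (τ a) := by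
  have h : ∃ j, τ j = j := ⟨j, hj⟩
  have e : h.choose = j := hτ.fixed_unique hα hj h.choose_spec
  rw [moveFixedPoint, dif_pos h, e, if_neg hjs]

open Classical in
/-- The permutations of `α` consisting of one fixed point and one further cycle. -/
noncomputable def nearCycles (α : Type*) [Fintype α] [DecidableEq α] : Finset (Perm α) :=
  univ.filter IsNearCycle

theorem mem_nearCycles {τ : Perm α} : τ ∈ nearCycles α ↔ IsNearCycle τ := by
  simp [nearCycles]

/-- Only `τ` carrying `s` onto `t` contribute. On these, `moveFixedPoint` is an involution whose
effect on `s` is a single transposition. The points `v` and `w` keep it well defined in its two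
directions. -/
theorem sum_nearCycles_restrictSign_of_exchange (hα : 3 ≤ Fintype.card α) (π : Perm α)
    {s t : Finset α} (hπ : ∀ x, x ∈ t ↔ π x ∈ s) {a b v w : α} (h : IsExchange s t a b)
    (hvs : v ∈ s) (hvt : v ∈ t) (hws : w ∉ s) (hwt : w ∉ t) :
    ∑ τ ∈ nearCycles α, restrictSign (π * τ) s = 0 := by
  classical
  have hcard : #s = #t := by
    have : t.image π = s := by
      ext x
      simp only [mem_image, hπ]
      exact ⟨by rintro ⟨y, hy, rfl⟩; exact hy, fun hx => ⟨π⁻¹ x, by simpa using hx, by simp⟩⟩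
    rw [← this, card_image_of_injective _ π.injective]
  have hfull : ∀ τ : Perm α, restrictSign (π * τ) s ≠ 0 → ∀ x, x ∈ s ↔ τ x ∈ t := by
    intro τ hτ
    have h1 : ∀ x ∈ s, τ x ∈ t := fun x hx => by
      by_contra hx'
      exact hτ (restrictSign_eq_zero hx (by rwa [Perm.mul_apply, ← hπ]))
    have h2 : s.image τ = t := eq_of_subset_of_card_le (image_subset_iff.2 h1)
      (by rw [card_image_of_injective _ τ.injective, hcard])
    intro x
    rw [← h2]
    simp
  rw [← sum_filter_of_ne (p := fun τ => ∀ x, x ∈ s ↔ τ x ∈ t) fun τ _ hτ => hfull τ hτ]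
  have main : ∀ τ, τ ∈ (nearCycles α).filter (fun τ => ∀ x, x ∈ s ↔ τ x ∈ t) →
      restrictSign (π * moveFixedPoint s a b τ) s = - restrictSign (π * τ) s ∧
      moveFixedPoint s a b τ ∈ (nearCycles α).filter (fun τ => ∀ x, x ∈ s ↔ τ x ∈ t) ∧
      moveFixedPoint s a b (moveFixedPoint s a b τ) = τ := by
    intro τ hτ
    simp only [mem_filter, mem_nearCycles] at hτ ⊢
    obtain ⟨hτ, hst⟩ := hτ
    obtain ⟨j, hj⟩ := hτ.2
    by_cases hjs : j ∈ s
    · obtain ⟨haj, hub, hus, hnear, hfix, hja, hst'⟩ := h.move hτ hj hjs hws hwt hst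
      rw [moveFixedPoint_of_mem hα a b hτ hj hjs]
      refine ⟨?_, ⟨hnear, hst'⟩, ?_⟩
      -- Both `b` and `τ b` lie outside `s`, so only `swap a j` is visible on `s`.
      · refine restrictSign_swap h.left_mem hjs haj fun x hx => ?_
        have h1 : x ≠ b := fun e => h.right_notMem (e ▸ hx)
        have h2 : x ≠ τ b := fun e => hus (e ▸ hx)
        simp [swap_apply_of_ne_of_ne h1 h2]
      · rw [moveFixedPoint_of_notMem hα a b hnear hfix hus, hja]
        simp [mul_assoc]
    · obtain ⟨hbj, hva, hvs', hnear, hfix, hjb, hst'⟩ := h.compl.move (w := v) hτ hj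
        (by simpa using hjs) (by simpa using hvs) (by simpa using hvt)
        (fun x => by simpa using not_congr (hst x))
      have hvs' : τ a ∈ s := by simpa using hvs'
      rw [moveFixedPoint_of_notMem hα a b hτ hj hjs]
      refine ⟨?_, ⟨hnear, fun x => ?_⟩, ?_⟩
      -- Now `b` and `j` lie outside `s`, so only `swap a (τ a)` is visible.
      · refine restrictSign_swap h.left_mem hvs' hva.symm fun x hx => ?_
        have hx' : swap a (τ a) x ∈ s :=
          (mem_iff_of_swap_apply (by simp [h.left_mem, hvs']) x).2 hx
        have h1 : swap a (τ a) x ≠ b := fun e => h.right_notMem (e ▸ hx')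
        have h2 : swap a (τ a) x ≠ j := fun e => hjs (e ▸ hx')
        simp [swap_apply_of_ne_of_ne h1 h2]
      · have := hst' x
        rw [mem_compl, mem_compl] at this
        exact not_iff_not.1 this
      · rw [moveFixedPoint_of_mem hα a b hnear hfix hvs', hjb]
        simp [mul_assoc]
  refine sum_involution (fun τ _ => moveFixedPoint s a b τ) ?_ ?_ ?_ ?_
  · intro τ hτ
    rw [(main τ hτ).1, add_neg_cancel]
  · intro τ hτ hne e
    have := (main τ hτ).1
    rw [e] at this
    omega
  · exact fun τ hτ => (main τ hτ).2.1
  · exact fun τ hτ => (main τ hτ).2.2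

/-- Conjugation by `swap a b` reverses signs: when `τ` maps `s` into `t`, which misses `a` and `b`,
the outer swap does nothing and the inner one transposes two points of `s`. -/
theorem sum_nearCycles_restrictSign_of_two_mem (π : Perm α)
    {s t : Finset α} (hπ : ∀ x, x ∈ t ↔ π x ∈ s) {a b : α} (hab : a ≠ b) (has : a ∈ s) (hbs : b ∈ s)
    (hat : a ∉ t) (hbt : b ∉ t) :
    ∑ τ ∈ nearCycles α, restrictSign (π * τ) s = 0 := by
  have hneg : ∀ τ : Perm α, restrictSign (π * (swap a b * τ * swap a b)) s =
      - restrictSign (π * τ) s := by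
    intro τ
    by_cases hτ : ∀ x ∈ s, τ x ∈ t
    · refine restrictSign_swap has hbs hab fun x hx => ?_
      have hx' : τ (swap a b x) ∈ t :=
        hτ _ ((mem_iff_of_swap_apply (by simp [has, hbs]) x).2 hx)
      have h1 : τ (swap a b x) ≠ a := fun e => hat (e ▸ hx')
      have h2 : τ (swap a b x) ≠ b := fun e => hbt (e ▸ hx')
      simp [swap_apply_of_ne_of_ne h1 h2]
    · push Not at hτ
      obtain ⟨x, hx, hx'⟩ := hτ
      have hy : swap a b x ∈ s := (mem_iff_of_swap_apply (by simp [has, hbs]) x).2 hx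
      have hz : swap a b (τ x) ∉ t := fun h =>
        hx' ((mem_iff_of_swap_apply (by simp [hat, hbt]) _).1 h)
      rw [restrictSign_eq_zero (ω := π * τ) hx (by rwa [Perm.mul_apply, ← hπ]),
        restrictSign_eq_zero hy (by simpa [← hπ] using hz), neg_zero]
  refine sum_involution (fun τ _ => swap a b * τ * swap a b) ?_ ?_ ?_ ?_
  · intro τ _
    rw [hneg, add_neg_cancel]
  · intro τ _ hne e
    have := hneg τ
    rw [e] at this
    omega
  · intro τ hτ
    rw [mem_nearCycles] at hτ ⊢
    simpa using hτ.conj (swap a b)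
  · intro τ _
    simp [mul_assoc]

/-- With `t` the preimage of `s` under `π`, a nonzero term needs `τ` to map `s` into `t`. The
argument depends on whether `s \ t` has no, one or several elements. If `s = t`, then `s` would be
invariant, which its size forbids. -/
theorem sum_nearCycles_restrictSign (π : Perm α) {s : Finset α} (h2 : 2 ≤ #s)
    (hs : #s + 2 ≤ Fintype.card α) : ∑ τ ∈ nearCycles α, restrictSign (π * τ) s = 0 := by
  classical
  have hα : 3 ≤ Fintype.card α := by omega
  set t := s.image π.symm with ht
  have hπ : ∀ x, x ∈ t ↔ π x ∈ s := fun x => by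
    simp only [ht, mem_image]
    exact ⟨by rintro ⟨y, hy, rfl⟩; simpa using hy, fun hx => ⟨π x, hx, by simp⟩⟩
  have hcard : #t = #s := card_image_of_injective _ π.symm.injective
  have hd : #(t \ s) = #(s \ t) := card_sdiff_comm hcard
  rcases lt_trichotomy (#(s \ t)) 1 with h | h | h
  · have hst : s = t := by
      refine eq_of_subset_of_card_le ?_ hcard.le
      rw [← sdiff_eq_empty_iff_subset, ← card_eq_zero]
      omega
    refine sum_eq_zero fun τ hτ => ?_
    rw [mem_nearCycles] at hτ
    suffices ∃ x ∈ s, τ x ∉ t by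
      obtain ⟨x, hx, hx'⟩ := this
      exact restrictSign_eq_zero hx (by rwa [Perm.mul_apply, ← hπ])
    by_contra! hinv
    rw [← hst] at hinv
    obtain ⟨j, hj⟩ := hτ.2
    obtain ⟨x, hx, hxj⟩ := exists_mem_ne (by omega : 1 < #s) j
    have hsub : univ.erase j ⊆ s := fun y hy =>
      hτ.mem_of_invariant hj hinv hx hxj (ne_of_mem_erase hy)
    have := card_le_card hsub
    rw [card_erase_of_mem (mem_univ j), card_univ] at this
    omega
  · obtain ⟨a, ha⟩ := card_eq_one.1 h
    obtain ⟨b, hb⟩ := card_eq_one.1 (hd.trans h)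
    have ha' : ∀ x, x ∈ s ∧ x ∉ t ↔ x = a := fun x => by simpa using Finset.ext_iff.1 ha x
    have hb' : ∀ x, x ∈ t ∧ x ∉ s ↔ x = b := fun x => by simpa using Finset.ext_iff.1 hb x
    have hex : IsExchange s t a b :=
      ⟨((ha' a).2 rfl).1, ((ha' a).2 rfl).2, ((hb' b).2 rfl).2, ((hb' b).2 rfl).1,
        fun x hxa hxb => ⟨fun hx => by_contra fun hx' => hxa ((ha' x).1 ⟨hx, hx'⟩),
          fun hx => by_contra fun hx' => hxb ((hb' x).1 ⟨hx, hx'⟩)⟩⟩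
    obtain ⟨v, hv, hva⟩ := exists_mem_ne (by omega : 1 < #s) a
    have hvt : v ∈ t := by_contra fun hx' => hva ((ha' v).1 ⟨hv, hx'⟩)
    obtain ⟨w, hw⟩ : ∃ w, w ∉ insert b s := by
      by_contra! hall
      have := card_le_card (fun x _ => hall x : (univ : Finset α) ⊆ insert b s)
      rw [card_univ] at this
      have := card_insert_le b s
      omega
    rw [mem_insert, not_or] at hw
    exact sum_nearCycles_restrictSign_of_exchange hα π hπ hex hv hvt hw.2
      fun hx => hw.1 ((hb' w).1 ⟨hx, hw.2⟩)
  · obtain ⟨a, ha, b, hb, hab⟩ := one_lt_card.1 h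
    rw [mem_sdiff] at ha hb
    exact sum_nearCycles_restrictSign_of_two_mem π hπ hab ha.1 hb.1 ha.2 hb.2

end NearCycle

/-! ### Factorizations of a permutation through near cycles. -/

section Counting

variable {α : Type*} [Fintype α] [DecidableEq α]

/-- Near cycles with a given fixed point are permuted by conjugation. -/
theorem sum_nearCycles_conj {M : Type*} [AddCommMonoid M] (G : Perm α → M)
    (hG : ∀ g τ, G (g * τ * g⁻¹) = G τ) (g : Perm α) (s t : α) :
    ∑ τ ∈ nearCycles α with τ (g s) = g t, G τ = ∑ τ ∈ nearCycles α with τ s = t, G τ := by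
  refine (sum_bij' (fun τ _ => g * τ * g⁻¹) (fun τ _ => g⁻¹ * τ * g) ?_ ?_ ?_ ?_ ?_).symm
  · intro τ hτ
    simp only [mem_filter, mem_nearCycles] at hτ ⊢
    exact ⟨hτ.1.conj g, by simp [hτ.2]⟩
  · intro τ hτ
    simp only [mem_filter, mem_nearCycles] at hτ ⊢
    exact ⟨by simpa using hτ.1.conj g⁻¹, by simp [hτ.2]⟩
  · intro τ _
    group
  · intro τ _
    group
  · intro τ _
    exact (hG g τ).symm

theorem sum_nearCycles_fixed {M : Type*} [AddCommMonoid M] (hα : 3 ≤ Fintype.card α)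
    (G : Perm α → M) (hG : ∀ g τ, G (g * τ * g⁻¹) = G τ) (r : α) :
    ∑ τ ∈ nearCycles α, G τ = Fintype.card α • ∑ τ ∈ nearCycles α with τ r = r, G τ := by
  have h1 : ∀ j, ∑ τ ∈ nearCycles α with τ j = j, G τ = ∑ τ ∈ nearCycles α with τ r = r, G τ := by
    intro j
    simpa using sum_nearCycles_conj G hG (swap r j) r r
  rw [← card_univ, ← sum_const, ← sum_congr rfl fun j _ => h1 j]
  simp only [sum_filter]
  rw [sum_comm]
  refine sum_congr rfl fun τ hτ => ?_
  rw [mem_nearCycles] at hτ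
  obtain ⟨j, hj⟩ := hτ.2
  rw [sum_eq_single j (fun i _ hi => if_neg fun e => hi (hτ.fixed_unique hα hj e)) (by simp),
    if_pos hj]

theorem card_nearCycles (hα : 3 ≤ Fintype.card α) (r : α) :
    #(nearCycles α) = Fintype.card α * #{τ ∈ nearCycles α | τ r = r} := by
  simpa using sum_nearCycles_fixed hα (fun _ => (1 : ℕ)) (fun _ _ => rfl) r

/-- The image of a given point under a random near cycle is uniformly distributed. -/
theorem card_nearCycles_apply_eq (hα : 3 ≤ Fintype.card α) (r s t : α) :
    #{τ ∈ nearCycles α | τ s = t} = #{τ ∈ nearCycles α | τ r = r} := by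
  have hconj : ∀ g : Perm α, ∀ s t, #{τ ∈ nearCycles α | τ (g s) = g t} =
      #{τ ∈ nearCycles α | τ s = t} := fun g s t => by
    simpa using sum_nearCycles_conj (fun _ => (1 : ℕ)) (fun _ _ => rfl) g s t
  have hfix : #{τ ∈ nearCycles α | τ s = s} = #{τ ∈ nearCycles α | τ r = r} := by
    simpa using hconj (swap r s) r r
  by_cases hst : t = s
  · rw [hst, hfix]
  have hother : ∀ u ∈ univ.erase s, #{τ ∈ nearCycles α | τ s = u} =
      #{τ ∈ nearCycles α | τ s = t} := by
    intro u hu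
    have hu := ne_of_mem_erase hu
    have := hconj (swap t u) s t
    rwa [swap_apply_left, swap_apply_of_ne_of_ne (Ne.symm hst) hu.symm] at this
  -- The fibres over the values of `τ s` average to the number with fixed point `r`. The fibre at
  -- `s` has that size and the others are equal, so all do.
  have htot := card_eq_sum_card_fiberwise (f := fun τ : Perm α => τ s) (s := nearCycles α)
    (t := univ) (fun _ _ => mem_coe.2 (mem_univ _))
  rw [card_nearCycles hα r, ← add_sum_erase _ _ (mem_univ s), sum_congr rfl hother, sum_const,
    card_erase_of_mem (mem_univ s), card_univ, hfix, smul_eq_mul] at htot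
  obtain ⟨m, hm⟩ : ∃ m, Fintype.card α = m + 2 := ⟨Fintype.card α - 2, by omega⟩
  rw [hm, show m + 2 - 1 = m + 1 from rfl] at htot
  have : (m + 1) * #{τ ∈ nearCycles α | τ s = t} = (m + 1) * #{τ ∈ nearCycles α | τ r = r} := by
    linarith
  exact Nat.eq_of_mul_eq_mul_left (Nat.succ_pos m) this

/-- The product of a random full cycle and a random near cycle is uniformly distributed on the odd
permutations. -/
theorem card_nearCycles_mul_eq (hα : 3 ≤ Fintype.card α) (π : Perm α) (r : α) :
    (#{τ ∈ nearCycles α | cycleCount (π * τ) = 1} : ℤ) =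
      #{τ ∈ nearCycles α | τ r = r} * (1 - sign π) := by
  set k := #{τ ∈ nearCycles α | τ r = r} with hk
  have hcount : ∀ x, #{τ ∈ nearCycles α | π (τ x) = x} = k := fun x => by
    rw [hk, ← card_nearCycles_apply_eq hα r x (π.symm x)]
    congr 1
    ext τ
    simp [Equiv.eq_symm_apply]
  obtain ⟨m, hm⟩ : ∃ m, Fintype.card α = m + 3 := ⟨Fintype.card α - 3, by omega⟩
  have hcard : #(univ.erase r) = m + 2 := by
    rw [card_erase_of_mem (mem_univ r), card_univ, hm]
    rfl
  have h1 : (#{τ ∈ nearCycles α | cycleCount (π * τ) = 1} : ℤ) =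
      ∑ s ∈ (univ.erase r).powerset,
        (-1) ^ #s * ∑ τ ∈ nearCycles α, restrictSign (π * τ) s := by
    simp only [mul_sum]
    rw [sum_comm]
    simp only [sum_restrictSign]
    simp
  -- Sort the sets by size, isolating sizes `0`, `1` and `card α - 1`; all sizes between cancel.
  rw [h1, sum_powerset, hcard, sum_range_succ, ← hcard, powersetCard_self, hcard,
    sum_range_succ', sum_range_succ']
  have hmid : ∑ j ∈ range m, ∑ s ∈ powersetCard (j + 1 + 1) (univ.erase r),
      (-1) ^ #s * ∑ τ ∈ nearCycles α, restrictSign (π * τ) s = 0 := by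
    refine sum_eq_zero fun j hj => sum_eq_zero fun s hs => ?_
    rw [mem_range] at hj
    rw [mem_powersetCard] at hs
    rw [sum_nearCycles_restrictSign π (by omega) (by omega), mul_zero]
  have hlast : ∑ τ ∈ nearCycles α, restrictSign (π * τ) (univ.erase r) =
      k * (sign π * (-1) ^ (m + 3)) := by
    have : ∀ τ ∈ nearCycles α, restrictSign (π * τ) (univ.erase r) =
        if π (τ r) = r then (sign π * (-1) ^ (m + 3) : ℤ) else 0 := by
      intro τ hτ
      rw [mem_nearCycles] at hτ
      rw [restrictSign_erase, Perm.sign_mul, hτ.sign_eq hα, hm]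
      push_cast
      rfl
    rw [sum_congr rfl this, ← sum_filter, sum_const, hcount, nsmul_eq_mul]
  have hone : ∀ x, ∑ τ ∈ nearCycles α, restrictSign (π * τ) {x} = k := by
    intro x
    simp only [restrictSign_singleton]
    rw [← sum_filter, sum_const, nsmul_one]
    exact congrArg Nat.cast (hcount x)
  rw [hmid, sum_singleton, hlast, hcard, zero_add, powersetCard_zero, sum_singleton, zero_add,
    powersetCard_one, sum_map]
  simp only [Function.Embedding.coeFn_mk, hone, restrictSign_empty, card_singleton, sum_const,
    hcard, card_empty, card_nearCycles hα r, ← hk, hm]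
  have hpow : ((-1 : ℤ) ^ (m + 2)) * (-1) ^ (m + 3) = -1 := by
    rw [← pow_add, Odd.neg_one_pow ⟨m + 2, by ring⟩]
  simp only [nsmul_eq_mul]
  push_cast
  linear_combination (k * (sign π : ℤ) : ℤ) * hpow

end Counting

/-! ### Adding a point: from two full cycles to a random odd permutation. -/

section FullCycles

variable {β : Type*} [Fintype β] [DecidableEq β]

/-- The permutations with a single cycle. -/
noncomputable def fullCycles (β : Type*) [Fintype β] [DecidableEq β] : Finset (Perm β) :=
  {σ | cycleCount σ = 1}

theorem mem_fullCycles {σ : Perm β} : σ ∈ fullCycles β ↔ cycleCount σ = 1 := by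
  simp [fullCycles]

theorem sum_perm_option {M : Type*} [AddCommMonoid M] (f : Perm (Option β) → M) :
    ∑ π, f π = ∑ x, ∑ σ : Perm β, f (swap none x * optionCongr σ) := by
  rw [← Fintype.sum_prod_type', ← decomposeOption.symm.sum_comp]
  rfl

theorem sum_fullCycles_option [Nonempty β] {M : Type*} [AddCommMonoid M]
    (f : Perm (Option β) → M) :
    ∑ π ∈ fullCycles (Option β), f π =
      ∑ i : β, ∑ σ ∈ fullCycles β, f (swap none (some i) * optionCongr σ) := by
  simp only [fullCycles, sum_filter]
  rw [sum_perm_option, Fintype.sum_option]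
  simp only [cycleCount_swap_none_mul_optionCongr]
  have : ∀ σ : Perm β, cycleCount σ ≠ 0 := fun σ => (cycleCount_pos σ).ne'
  simp [this]

theorem sum_nearCycles_option [Nonempty β] {M : Type*} [AddCommMonoid M]
    (f : Perm (Option β) → M) :
    ∑ τ ∈ nearCycles (Option β) with τ none = none, f τ =
      ∑ σ ∈ fullCycles β, f (optionCongr σ) := by
  refine (sum_nbij (fun σ => optionCongr σ) ?_ ?_ ?_ (fun _ _ => rfl)).symm
  · intro σ hσ
    rw [mem_fullCycles] at hσ
    simp only [mem_filter, mem_nearCycles]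
    exact ⟨⟨by rw [cycleCount_optionCongr, hσ], none, by simp⟩, by simp⟩
  · exact fun _ _ _ _ h => optionCongr_injective h
  · intro τ hτ
    rw [mem_coe, mem_filter, mem_nearCycles] at hτ
    obtain ⟨σ, rfl⟩ : ∃ σ : Perm β, τ = optionCongr σ := by
      refine ⟨removeNone τ, ?_⟩
      have := decomposeOption.symm_apply_apply τ
      simp only [decomposeOption_apply, decomposeOption_symm_apply, hτ.2, swap_self] at this
      exact this.symm
    refine ⟨σ, ?_, rfl⟩
    have := hτ.1.1
    rw [cycleCount_optionCongr] at this
    rw [mem_coe, mem_fullCycles]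
    omega

/-- Both sides evaluate the sum of `h (cycleCount (ω * τ))` over full cycles `ω` and near cycles `τ`
of `Option β`. On the left, conjugation moves the fixed point of `τ` to `none`, and the `card β`
places for splicing `none` into `ω` do not affect the cycle count. On the right, the pairs are
grouped by their product. -/
theorem sum_fullCycles_mul (hβ : 2 ≤ Fintype.card β) (h : ℕ → ℝ) :
    ((Fintype.card β + 1 : ℕ) * Fintype.card β : ℝ) *
        ∑ σ ∈ fullCycles β, ∑ τ ∈ fullCycles β, h (cycleCount (σ * τ)) =
      #(fullCycles β) *
        ∑ π : Perm (Option β), (1 - ((sign π : ℤ) : ℝ)) * h (cycleCount π) := by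
  have : Nonempty β := Fintype.card_pos_iff.1 (by omega)
  have hα : 3 ≤ Fintype.card (Option β) := by rw [Fintype.card_option]; omega
  have hk : #{τ ∈ nearCycles (Option β) | τ none = none} = #(fullCycles β) := by
    simpa using sum_nearCycles_option (β := β) (fun _ => (1 : ℕ))
  let G : Perm (Option β) → ℝ := fun τ => ∑ ω ∈ fullCycles (Option β), h (cycleCount (ω * τ))
  have hG : ∀ g τ, G (g * τ * g⁻¹) = G τ := by
    intro g τ
    refine sum_bij' (fun ω _ => g⁻¹ * ω * g) (fun ω _ => g * ω * g⁻¹) ?_ ?_ ?_ ?_ ?_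
    · intro ω hω
      rw [mem_fullCycles] at hω ⊢
      simpa [hω] using cycleCount_conj g⁻¹ ω
    · intro ω hω
      rw [mem_fullCycles] at hω ⊢
      simpa [hω] using cycleCount_conj g ω
    · intro ω _
      group
    · intro ω _
      group
    · intro ω _
      rw [← cycleCount_conj g (g⁻¹ * ω * g * τ)]
      congr 2
      group
  have hsum : ∑ τ ∈ nearCycles (Option β), G τ = #(fullCycles β) *
      ∑ π : Perm (Option β), (1 - ((sign π : ℤ) : ℝ)) * h (cycleCount π) := by
    -- Passing to `τ⁻¹` turns `π = ω * τ⁻¹` into the condition that `π * τ` be a full cycle, as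
    -- counted by `card_nearCycles_mul_eq`.
    have hinv : ∑ τ ∈ nearCycles (Option β), G τ = ∑ τ ∈ nearCycles (Option β), G τ⁻¹ := by
      refine sum_bij' (fun τ _ => τ⁻¹) (fun τ _ => τ⁻¹) ?_ ?_ ?_ ?_ ?_ <;>
        simp +contextual [mem_nearCycles, IsNearCycle.inv]
    have hshift : ∀ τ, G τ⁻¹ = ∑ π : Perm (Option β),
        if cycleCount (π * τ) = 1 then h (cycleCount π) else 0 := by
      intro τ
      simp only [G, fullCycles, sum_filter]
      rw [← Equiv.sum_comp (Equiv.mulRight τ)]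
      simp
    rw [hinv, sum_congr rfl fun τ _ => hshift τ, sum_comm, mul_sum]
    refine sum_congr rfl fun π _ => ?_
    rw [← sum_filter, sum_const, nsmul_eq_mul, ← mul_assoc]
    congr 1
    have := card_nearCycles_mul_eq hα π none
    rw [hk] at this
    exact_mod_cast this
  rw [← hsum, sum_nearCycles_fixed hα G hG none, sum_nearCycles_option, Fintype.card_option,
    nsmul_eq_mul, mul_assoc]
  congr 1
  rw [sum_comm, mul_sum]
  refine sum_congr rfl fun τ _ => ?_
  simp only [G]
  rw [sum_fullCycles_option]
  have : ∀ i : β, ∀ σ : Perm β,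
      cycleCount (swap none (some i) * optionCongr σ * optionCongr τ) = cycleCount (σ * τ) := by
    intro i σ
    have e : (optionCongr σ * optionCongr τ : Perm (Option β)) = optionCongr (σ * τ) := by
      ext1 x
      cases x <;> simp
    rw [mul_assoc, e, cycleCount_swap_none_mul_optionCongr]
    simp
  simp [this]

theorem sum_cycleCount_option :
    ∑ π : Perm (Option β), (cycleCount π : ℝ) =
      (Fintype.card β + 1 : ℕ) * ∑ σ : Perm β, (cycleCount σ : ℝ) +
        (Fintype.card β).factorial := by
  rw [sum_perm_option, Fintype.sum_option]
  simp only [cycleCount_swap_none_mul_optionCongr]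
  simp [sum_add_distrib, Fintype.card_perm]
  ring

/-- The choice `none` keeps the sign and adds a cycle; each of the `card β` other choices flips the
sign and keeps the cycle count. -/
theorem sum_sign_mul_cycleCount_option :
    ∑ π : Perm (Option β), ((sign π : ℤ) : ℝ) * cycleCount π =
      (1 - Fintype.card β) * ∑ σ : Perm β, ((sign σ : ℤ) : ℝ) * (cycleCount σ : ℝ) +
        ∑ σ : Perm β, ((sign σ : ℤ) : ℝ) := by
  rw [sum_perm_option, Fintype.sum_option]
  simp only [cycleCount_swap_none_mul_optionCongr, Perm.sign_mul, optionCongr_sign]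
  simp [sum_add_distrib, mul_add]
  ring

end FullCycles

/-! ### Averages of cycle counts over all and over odd permutations. -/

section Average

theorem sum_cycleCount_congr {α β : Type*} [Fintype α] [DecidableEq α] [Fintype β]
    [DecidableEq β] (e : α ≃ β) :
    ∑ π : Perm α, (cycleCount π : ℝ) = ∑ π : Perm β, (cycleCount π : ℝ) := by
  rw [← Equiv.sum_comp e.permCongr]
  simp [cycleCount_permCongr]

theorem sum_sign_mul_cycleCount_congr {α β : Type*} [Fintype α] [DecidableEq α] [Fintype β]
    [DecidableEq β] (e : α ≃ β) :
    ∑ π : Perm α, ((sign π : ℤ) : ℝ) * cycleCount π =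
      ∑ π : Perm β, ((sign π : ℤ) : ℝ) * cycleCount π := by
  rw [← Equiv.sum_comp e.permCongr]
  simp [cycleCount_permCongr]

theorem sum_sign_eq_zero {α : Type*} [Fintype α] [DecidableEq α] [Nontrivial α] :
    ∑ σ : Perm α, ((sign σ : ℤ) : ℝ) = 0 := by
  obtain ⟨a, b, hab⟩ := exists_pair_ne α
  have h := Equiv.sum_comp (Equiv.mulRight (swap a b)) fun σ : Perm α => ((sign σ : ℤ) : ℝ)
  simp only [Equiv.coe_mulRight, Perm.sign_mul, sign_swap hab] at h
  simp only [mul_neg, mul_one, Units.val_neg, Int.cast_neg, sum_neg_distrib] at h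
  linarith

theorem sum_cycleCount_fin (n : ℕ) :
    ∑ π : Perm (Fin n), (cycleCount π : ℝ) = n.factorial * harmonic n := by
  induction n with
  | zero => simp [cycleCount]
  | succ n ih =>
    rw [sum_cycleCount_congr (finSuccEquiv n), sum_cycleCount_option, ih, Fintype.card_fin,
      harmonic_succ, Nat.factorial_succ]
    push_cast
    field_simp

theorem sum_sign_mul_cycleCount_fin (n : ℕ) :
    ∑ π : Perm (Fin (n + 2)), ((sign π : ℤ) : ℝ) * cycleCount π = (-1) ^ n * n.factorial := by
  induction n with
  | zero =>
    rw [sum_sign_mul_cycleCount_congr (finSuccEquiv 1), sum_sign_mul_cycleCount_option]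
    simp
  | succ n ih =>
    rw [sum_sign_mul_cycleCount_congr (finSuccEquiv (n + 2)), sum_sign_mul_cycleCount_option, ih,
      sum_sign_eq_zero, Fintype.card_fin, Nat.factorial_succ]
    push_cast
    ring

theorem fullCycles_nonempty (n : ℕ) : (fullCycles (Fin (n + 2))).Nonempty := by
  refine ⟨finRotate (n + 2), ?_⟩
  rw [mem_fullCycles, cycleCount_eq_one_iff]
  intro x y
  refine isCycle_finRotate.sameCycle ?_ ?_ <;> rw [← mem_support, support_finRotate] <;> simp

/-- The average number of cycles of the product of two full cycles of length `n + 2`. -/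
theorem average_cycleCount_mul (n : ℕ) :
    (∑ σ ∈ fullCycles (Fin (n + 2)), ∑ τ ∈ fullCycles (Fin (n + 2)), (cycleCount (σ * τ) : ℝ)) =
      (#(fullCycles (Fin (n + 2))) : ℝ) ^ 2 *
        (harmonic (n + 3) + (-1) ^ n / ((n + 2) * (n + 3))) := by
  have hpos : (0 : ℝ) < #(fullCycles (Fin (n + 2))) :=
    Nat.cast_pos.2 (card_pos.2 (fullCycles_nonempty n))
  -- The constant function `1` yields the number of full cycles, so no separate count is needed; the
  -- identity function yields the wanted sum.
  have h1 := sum_fullCycles_mul (β := Fin (n + 2)) (by simp) (fun _ => 1)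
  have h2 := sum_fullCycles_mul (β := Fin (n + 2)) (by simp) (fun m => m)
  have hs : ∑ π : Perm (Option (Fin (n + 2))), ((sign π : ℤ) : ℝ) = 0 := sum_sign_eq_zero
  simp only [mul_one, sum_sub_distrib, hs, sum_const, card_univ, Fintype.card_perm,
    Fintype.card_option, Fintype.card_fin, nsmul_eq_mul, sub_zero] at h1
  simp only [sub_mul, one_mul, sum_sub_distrib, Fintype.card_fin] at h2
  rw [sum_cycleCount_congr (finSuccEquiv (n + 2)).symm,
    sum_sign_mul_cycleCount_congr (finSuccEquiv (n + 2)).symm, sum_cycleCount_fin,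
    sum_sign_mul_cycleCount_fin] at h2
  set c : ℝ := (#(fullCycles (Fin (n + 2))) : ℝ)
  set S := ∑ σ ∈ fullCycles (Fin (n + 2)), ∑ τ ∈ fullCycles (Fin (n + 2)),
    (cycleCount (σ * τ) : ℝ)
  have h3 : ((n + 2 + 1 : ℕ) * (n + 2 : ℕ) : ℝ) * c = (n + 2 + 1).factorial := by
    refine mul_left_cancel₀ hpos.ne' ?_
    linear_combination h1
  have hf : ((n + 2 + 1).factorial : ℝ) = (n + 3) * (n + 2) * (n + 1).factorial := by
    rw [Nat.factorial_succ, Nat.factorial_succ (n + 1)]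
    push_cast
    ring
  have hc : c = (n + 1).factorial := by
    rw [hf] at h3
    push_cast at h3
    have : ((n : ℝ) + 3) * (n + 2) ≠ 0 := by positivity
    refine mul_left_cancel₀ this ?_
    linear_combination h3
  rw [hf, ← hc, pow_succ] at h2
  push_cast at h2
  field_simp
  linear_combination h2

end Average

/-! ### Embeddings of the dipole as pairs of full cycles. -/

section Dipole

/-- The darts of the dipole at the vertex `b` correspond to the edges. -/
def dartsAtEquiv (n : ℕ) (b : Bool) : (dipole n).DartsAt b ≃ Fin n where
  toFun d := d.1.1
  invFun e := ⟨(e, b), rfl⟩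
  left_inv := by
    rintro ⟨⟨e, b⟩, rfl⟩
    rfl
  right_inv _ := rfl

variable {n : ℕ}

/-- The permutation of the edges given by the local rotation at the vertex `b`. -/
def edgePerm (M : (dipole n).Embedding) (b : Bool) : Perm (Fin n) :=
  (dartsAtEquiv n b).permCongr (M.rot b)

theorem edgePerm_mem_fullCycles [NeZero n] (M : (dipole n).Embedding) (b : Bool) :
    edgePerm M b ∈ fullCycles (Fin n) := by
  have : Nonempty ((dipole n).DartsAt b) := ⟨(dartsAtEquiv n b).symm 0⟩
  rw [mem_fullCycles, edgePerm, cycleCount_permCongr, ← isCycleOn_univ_iff]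
  exact M.isCycleOn b

/-- An embedding of the dipole is a pair of full cycles. -/
noncomputable def embeddingEquiv (n : ℕ) [NeZero n] :
    (dipole n).Embedding ≃ fullCycles (Fin n) × fullCycles (Fin n) where
  toFun M := (⟨edgePerm M true, edgePerm_mem_fullCycles M true⟩,
    ⟨edgePerm M false, edgePerm_mem_fullCycles M false⟩)
  invFun p :=
    { rot := fun b => (dartsAtEquiv n b).symm.permCongr (cond b p.1.1 p.2.1)
      isCycleOn := fun b => by
        have : Nonempty ((dipole n).DartsAt b) := ⟨(dartsAtEquiv n b).symm 0⟩
        rw [isCycleOn_univ_iff, cycleCount_permCongr]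
        cases b
        · exact mem_fullCycles.1 p.2.2
        · exact mem_fullCycles.1 p.1.2 }
  left_inv M := by
    refine DartGraph.Embedding.ext (funext fun b => Equiv.ext fun x => ?_)
    cases b <;> simp [edgePerm]
  right_inv p := by
    ext x <;> simp [edgePerm]

theorem facePerm_apply (M : (dipole n).Embedding) (e : Fin n) (b : Bool) :
    M.facePerm (e, b) = (edgePerm M b e, !b) := by
  have h : ((M.rot b ⟨(e, b), rfl⟩ : (dipole n).DartsAt b) : Fin n × Bool).2 = b :=
    (M.rot b ⟨(e, b), rfl⟩).2
  change (_, !((M.rot b ⟨(e, b), rfl⟩ : (dipole n).DartsAt b) : Fin n × Bool).2) = _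
  rw [h]
  rfl

/-- Every face meets the darts at `false`, and the square of the face permutation acts on them as
the product. A dart at `true` is represented by the edge of its successor. -/
theorem numFaces_eq (M : (dipole n).Embedding) :
    M.numFaces = cycleCount (edgePerm M true * edgePerm M false) := by
  refine cycleCount_eq_of_maps (σ := M.facePerm)
    (fun d => if d.2 then edgePerm M true d.1 else d.1) (fun e => (e, false)) ?_ ?_ ?_ ?_
  · rintro ⟨e, _ | _⟩
    · simpa [facePerm_apply] using sameCycle_apply (edgePerm M true * edgePerm M false) e
    · simp [facePerm_apply, SameCycle.refl]
  · intro e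
    simpa [facePerm_apply] using (sameCycle_apply M.facePerm (e, false)).trans
      (sameCycle_apply M.facePerm _)
  · rintro ⟨e, _ | _⟩
    · simp [SameCycle.refl]
    · simpa [facePerm_apply] using (sameCycle_apply M.facePerm (e, true)).symm
  · intro e
    simp [SameCycle.refl]

theorem integral_uniformOn_univ {Ω : Type*} [Fintype Ω] [MeasurableSpace Ω]
    [MeasurableSingletonClass Ω] (f : Ω → ℝ) :
    ∫ x, f x ∂(ProbabilityTheory.uniformOn Set.univ) = (Fintype.card Ω : ℝ)⁻¹ * ∑ x, f x := by
  rw [ProbabilityTheory.uniformOn, ProbabilityTheory.cond, MeasureTheory.integral_smul_measure,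
    MeasureTheory.Measure.restrict_univ,
    MeasureTheory.integral_fintype MeasureTheory.Integrable.of_finite]
  simp

theorem expectedFaces_dipole (n : ℕ) : (dipole (n + 2)).expectedFaces =
    harmonic (n + 3) + (-1) ^ n / ((n + 2) * (n + 3)) := by
  let e := embeddingEquiv (n + 2)
  let _ : Fintype (dipole (n + 2)).Embedding := Fintype.ofEquiv _ e.symm
  have : MeasurableSingletonClass (dipole (n + 2)).Embedding := ⟨fun _ => trivial⟩
  have hpos : (0 : ℝ) < #(fullCycles (Fin (n + 2))) :=
    Nat.cast_pos.2 (card_pos.2 (fullCycles_nonempty n))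
  have hsum : ∑ M : (dipole (n + 2)).Embedding, (M.numFaces : ℝ) =
      ∑ σ ∈ fullCycles (Fin (n + 2)), ∑ τ ∈ fullCycles (Fin (n + 2)),
        (cycleCount (σ * τ) : ℝ) := by
    rw [← sum_coe_sort (fullCycles _), ← e.symm.sum_comp, Fintype.sum_prod_type]
    refine sum_congr rfl fun σ _ => ?_
    rw [← sum_coe_sort (fullCycles _)]
    refine sum_congr rfl fun τ _ => ?_
    rw [numFaces_eq]
    have h := e.apply_symm_apply (σ, τ)
    rw [show edgePerm (e.symm (σ, τ)) true = σ from congrArg (fun p => p.1.1) h,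
      show edgePerm (e.symm (σ, τ)) false = τ from congrArg (fun p => p.2.1) h]
  rw [DartGraph.expectedFaces, integral_uniformOn_univ, hsum, average_cycleCount_mul,
    Fintype.card_congr e, Fintype.card_prod, Fintype.card_coe]
  push_cast
  field_simp

end Dipole

end DipoleFaces

/-! ### The closed form by parity, via `1 / (n * (n + 1)) = 1 / n - 1 / (n + 1)`. -/

theorem corollary2p2 (n : ℕ) (hn : 2 ≤ n) :
    (dipole n).expectedFaces =
        (if Even n then (harmonic (n - 1) : ℝ) + 2 / (n : ℝ)
          else (harmonic (n - 1) : ℝ) + 2 / ((n : ℝ) + 1)) ∧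
      (dipole n).expectedFaces = (harmonic (n - 1) : ℝ) + ((⌈(n : ℝ) / 2⌉ : ℤ) : ℝ)⁻¹ := by
  obtain ⟨m, rfl⟩ : ∃ m, n = m + 2 := ⟨n - 2, by omega⟩
  have hE := DipoleFaces.expectedFaces_dipole m
  rw [harmonic_succ, harmonic_succ] at hE
  rw [show m + 2 - 1 = m + 1 from rfl]
  have h2 : ((m : ℝ) + 2) ≠ 0 := by positivity
  have h3 : ((m : ℝ) + 3) ≠ 0 := by positivity
  rcases Nat.even_or_odd m with hm | hm
  · have hev : Even (m + 2) := by simpa [Nat.even_add] using hm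
    have hval : (dipole (m + 2)).expectedFaces =
        (harmonic (m + 1) : ℝ) + 2 / ((m + 2 : ℕ) : ℝ) := by
      rw [hE, hm.neg_one_pow]
      push_cast
      have h2' : ((m : ℝ) + 1 + 1) ≠ 0 := by positivity
      have h3' : ((m : ℝ) + 2 + 1) ≠ 0 := by positivity
      field_simp
      ring
    refine ⟨by rw [if_pos hev, hval], ?_⟩
    obtain ⟨k, rfl⟩ := hm
    have hceil : ⌈((k + k + 2 : ℕ) : ℝ) / 2⌉ = (k + 1 : ℤ) := by
      rw [show ((k + k + 2 : ℕ) : ℝ) / 2 = ((k + 1 : ℤ) : ℝ) by push_cast; ring, Int.ceil_intCast]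
    rw [hval, hceil]
    push_cast
    congr 1
    field_simp
    ring
  · have hodd : ¬ Even (m + 2) := by simpa [Nat.even_add] using hm
    have hval : (dipole (m + 2)).expectedFaces =
        (harmonic (m + 1) : ℝ) + 2 / (((m + 2 : ℕ) : ℝ) + 1) := by
      rw [hE, hm.neg_one_pow]
      push_cast
      have h2' : ((m : ℝ) + 1 + 1) ≠ 0 := by positivity
      have h3' : ((m : ℝ) + 2 + 1) ≠ 0 := by positivity
      field_simp
      ring
    refine ⟨by rw [if_neg hodd, hval], ?_⟩
    obtain ⟨k, rfl⟩ := hm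
    have hceil : ⌈((2 * k + 1 + 2 : ℕ) : ℝ) / 2⌉ = (k + 2 : ℤ) := by
      rw [Int.ceil_eq_iff]
      push_cast
      constructor <;> linarith
    rw [hval, hceil]
    push_cast
    congr 1
    field_simp
    ring
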